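/- Let $r_1,r_2$ be positive integers and let $\mathcal F_2=\mathbb Q\langle y_1^{\pm1},y_2^{\pm1}\rangle$ be the group algebra over $\mathbb Q$ of the free group on $y_1,y_2$ (its elements are the noncommutative Laurent polynomials in $y_1,y_2$). Put $z=y_2^{-1}y_1y_2y_1^{-1}$, and for $k\in\mathbb Z$ let $r_k=r_1$ if $k$ is odd and $r_k=r_2$ if $k$ is even. Let $D$ be any division ring containing $\mathcal F_2$ as a subring (for example a skew field of fractions $\mathrm{Frac}(\mathcal F_2)$, which exists by a theorem of Malcev). Then there is exactly one family $(y_k)_{k\in\mathbb Z}$ in $D$ whose terms $y_1,y_2$ are the given generators and which satisfies $$y_{k+1}\,z\,y_{k-1}=1+y_k^{r_k}\qquad\text{for all }k\in\mathbb Z.$$ Let $\mathcal A$ be the $\mathbb Q$-subalgebra generated by $y_0,y_1,y_2,y_3,z,z^{-1}$. Then $\mathcal A\subseteq\mathcal F_2$, and $y_k\in\mathcal A$ for every $k\in\mathbb Z$. In particular every $y_k$ is a noncommutative Laurent polynomial in $y_1,y_2$ (with coefficients in $\mathbb Q$). -/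

import Mathlib

/-- The group algebra over `ℚ` of the free group on two generators, i.e. the algebra
`ℚ⟨y₁^{±1}, y₂^{±1}⟩` of noncommutative Laurent polynomials in two variables. -/
abbrev NCLaurent : Type := MonoidAlgebra ℚ (FreeGroup (Fin 2))

namespace NCLaurent

/-- The first generator `y₁` of the free group. -/
def g₁ : FreeGroup (Fin 2) := FreeGroup.of 0

/-- The second generator `y₂` of the free group. -/
def g₂ : FreeGroup (Fin 2) := FreeGroup.of 1

/-- A group element regarded as a (monic monomial) noncommutative Laurent polynomial. -/
noncomputable def mono (g : FreeGroup (Fin 2)) : NCLaurent :=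
  MonoidAlgebra.of ℚ (FreeGroup (Fin 2)) g

/-- `z = y₂⁻¹ y₁ y₂ y₁⁻¹`, as an element of the free group. -/
def gz : FreeGroup (Fin 2) := g₂⁻¹ * g₁ * g₂ * g₁⁻¹

/-- The exponent `r_k`: it is `r₁` for odd `k` and `r₂` for even `k`. -/
def exponent (r₁ r₂ : ℕ) (k : ℤ) : ℕ := if Odd k then r₁ else r₂

/-- For an algebra map `ι` from the noncommutative Laurent polynomials to `D` (in the theorem: an
embedding into a division ring), `y : ℤ → D` is the sequence with the given initial terms
`y₁`, `y₂` and with `y_{k+1} z y_{k-1} = 1 + y_k ^ r_k` for all integers `k`. -/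
structure IsClusterSeq (r₁ r₂ : ℕ) {D : Type*} [Ring D] [Algebra ℚ D] (ι : NCLaurent →ₐ[ℚ] D)
    (y : ℤ → D) : Prop where
  one : y 1 = ι (mono g₁)
  two : y 2 = ι (mono g₂)
  rec_eq : ∀ k : ℤ, y (k + 1) * ι (mono gz) * y (k - 1) = 1 + y k ^ exponent r₁ r₂ k

/-- The subalgebra generated by `y₀, y₁, y₂, y₃, z, z⁻¹`. -/
def clusterAlgebra {D : Type*} [Ring D] [Algebra ℚ D] (ι : NCLaurent →ₐ[ℚ] D) (y : ℤ → D) :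
    Subalgebra ℚ D :=
  Algebra.adjoin ℚ {y 0, y 1, y 2, y 3, ι (mono gz), ι (mono gz⁻¹)}

end NCLaurent

/-! This is a rank two Laurent phenomenon. Take consecutive terms `a, b, c, d` with `c * z * b = b *
c`; this relation holds for `y₁, y₂` by the choice of `z`, and the exchange relations propagate it.
Expanding `d ^ r * (z * b) ^ r = 1 + P * c` with `P` in the algebra shows that the next term is `e =
(d ^ r * z * a - P) * z⁻¹`, so no division by `c` remains (`mem_forward`; `mem_backward` is the
mirror image).

These cancellations need nonzero terms. Sending `y₁, y₂` to `1` turns the exchange relation into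
`a_{k+1} * a_{k-1} = 1 + a_k ^ r_k` over `ℚ`, so all terms have positive augmentation. Membership
and positivity are proved together by induction on windows of four terms (`IsWindow`). The induction
also serves existence, since it needs only `IsWeakClusterSeq`. -/

namespace NCLaurent

/-! ### Identities in a division ring from quasi-commutation and exchange. -/

section Exchange

variable {D : Type*} [DivisionRing D]

/-- Conjugation by `c` turns `z * b` into `b`, also on powers. -/
theorem mul_pow_eq_pow_mul_of_quasi_comm {b c z : D} (h : c * z * b = b * c) (n : ℕ) :
    c * (z * b) ^ n = b ^ n * c :=
  (SemiconjBy.pow_right (show c * (z * b) = b * c by rw [← mul_assoc, h]) n)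

/-- Conjugation by `b` turns `c` into `c * z`, also on powers. -/
theorem pow_mul_eq_mul_pow_of_quasi_comm {b c z : D} (h : c * z * b = b * c) (n : ℕ) :
    (c * z) ^ n * b = b * c ^ n :=
  (SemiconjBy.pow_right (show b * c = c * z * b from h.symm) n).symm

/-- Quasi-commutation propagates forward along the exchange relation. -/
theorem quasi_comm_forward {b c d z : D} {s : ℕ} (hz : z ≠ 0) (hb : b ≠ 0)
    (hcb : c * z * b = b * c) (hdb : d * z * b = 1 + c ^ s) : d * z * c = c * d := by
  refine mul_right_cancel₀ (mul_ne_zero hz hb) ?_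
  calc d * z * c * (z * b) = d * z * (c * z * b) := by simp only [mul_assoc]
    _ = d * z * b * c := by rw [hcb]; simp only [mul_assoc]
    -- `d * z * b` is a polynomial in `c`.
    _ = c * (d * z * b) := by
      rw [hdb, add_mul, mul_add, one_mul, mul_one, ← pow_succ, ← pow_succ']
    _ = c * d * (z * b) := by simp only [mul_assoc]

/-- Quasi-commutation propagates backward along the exchange relation. -/
theorem quasi_comm_backward {a b c z : D} {r : ℕ} (hz : z ≠ 0) (hc : c ≠ 0)
    (hcb : c * z * b = b * c) (hca : c * z * a = 1 + b ^ r) : b * z * a = a * b := by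
  refine mul_left_cancel₀ (mul_ne_zero hc hz) ?_
  calc c * z * (b * z * a) = c * z * b * (z * a) := by simp only [mul_assoc]
    _ = b * (c * z * a) := by rw [hcb]; simp only [mul_assoc]
    _ = c * z * a * b := by
      rw [hca, add_mul, mul_add, one_mul, mul_one, ← pow_succ, ← pow_succ']
    _ = c * z * (a * b) := by simp only [mul_assoc]

variable [Algebra ℚ D] (S : Subalgebra ℚ D)

/-- The innermost `d * z * b` is `1 + c ^ s`. The `1` lowers `n`; in the other term one factor `c`
moves to the far right, turning `(z * b) ^ n` into `b ^ n`. -/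
theorem exists_pow_mul_pow_eq_one_add_mul {b c d z : D} {s : ℕ} (hs : 0 < s)
    (hcb : c * z * b = b * c) (hdb : d * z * b = 1 + c ^ s)
    (hbS : b ∈ S) (hcS : c ∈ S) (hdS : d ∈ S) (n : ℕ) :
    ∃ P ∈ S, d ^ n * (z * b) ^ n = 1 + P * c := by
  induction n with
  | zero => exact ⟨0, S.zero_mem, by simp⟩
  | succ n ih =>
    obtain ⟨P, hP, h⟩ := ih
    -- Positivity of `s` supplies the factor `c` to be moved.
    obtain ⟨t, rfl⟩ := Nat.exists_eq_add_of_lt hs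
    refine ⟨P + d ^ n * c ^ t * b ^ n, S.add_mem hP (S.mul_mem (S.mul_mem (S.pow_mem hdS _)
      (S.pow_mem hcS _)) (S.pow_mem hbS _)), ?_⟩
    calc d ^ (n + 1) * (z * b) ^ (n + 1)
        = d ^ n * (d * z * b) * (z * b) ^ n := by
          rw [pow_succ, pow_succ']; simp only [mul_assoc]
      _ = d ^ n * (z * b) ^ n + d ^ n * c ^ t * (c * (z * b) ^ n) := by
          rw [hdb, zero_add, pow_succ]; simp only [mul_add, add_mul, mul_one, mul_assoc]
      _ = 1 + (P + d ^ n * c ^ t * b ^ n) * c := by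
          rw [h, mul_pow_eq_pow_mul_of_quasi_comm hcb]
          simp only [add_mul, mul_assoc, add_assoc]

/-- Mirror image: reverse all products and swap `a` with `d` and `b` with `c`. -/
theorem exists_pow_mul_pow_eq_one_add_mul' {a b c z : D} {s : ℕ} (hs : 0 < s)
    (hcb : c * z * b = b * c) (hca : c * z * a = 1 + b ^ s)
    (haS : a ∈ S) (hbS : b ∈ S) (hcS : c ∈ S) (n : ℕ) :
    ∃ P ∈ S, (c * z) ^ n * a ^ n = 1 + b * P := by
  induction n with
  | zero => exact ⟨0, S.zero_mem, by simp⟩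
  | succ n ih =>
    obtain ⟨P, hP, h⟩ := ih
    obtain ⟨t, rfl⟩ := Nat.exists_eq_add_of_lt hs
    refine ⟨P + c ^ n * b ^ t * a ^ n, S.add_mem hP (S.mul_mem (S.mul_mem (S.pow_mem hcS _)
      (S.pow_mem hbS _)) (S.pow_mem haS _)), ?_⟩
    calc (c * z) ^ (n + 1) * a ^ (n + 1)
        = (c * z) ^ n * (c * z * a) * a ^ n := by
          rw [pow_succ, pow_succ']; simp only [mul_assoc]
      _ = (c * z) ^ n * a ^ n + (c * z) ^ n * b * (b ^ t * a ^ n) := by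
          rw [hca, zero_add, pow_succ']; simp only [mul_add, add_mul, mul_one, mul_assoc]
      _ = 1 + b * (P + c ^ n * b ^ t * a ^ n) := by
          rw [h, pow_mul_eq_mul_pow_of_quasi_comm hcb]
          simp only [mul_add, mul_assoc, add_assoc]

/-- The term after four consecutive terms lies in the subalgebra they generate with `z⁻¹`. -/
theorem mem_forward {a b c d e z : D} {r s : ℕ} (hs : 0 < s) (hz : z ≠ 0) (hc : c ≠ 0)
    (hcb : c * z * b = b * c) (hca : c * z * a = 1 + b ^ r) (hdb : d * z * b = 1 + c ^ s)
    (hec : e * z * c = 1 + d ^ r) (hzS : z ∈ S) (hziS : z⁻¹ ∈ S)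
    (haS : a ∈ S) (hbS : b ∈ S) (hcS : c ∈ S) (hdS : d ∈ S) : e ∈ S := by
  obtain ⟨P, hP, h⟩ := exists_pow_mul_pow_eq_one_add_mul S hs hcb hdb hbS hcS hdS r
  -- The relation `hca` conjugated by `c`.
  have hac : z * a * c = 1 + (z * b) ^ r := by
    refine mul_left_cancel₀ hc ?_
    calc c * (z * a * c) = c * z * a * c := by simp only [mul_assoc]
      _ = c * (1 + (z * b) ^ r) := by
        rw [hca, mul_add, mul_pow_eq_pow_mul_of_quasi_comm hcb, add_mul, one_mul, mul_one]
  have hez : e * z = d ^ r * z * a - P := by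
    refine mul_right_cancel₀ hc ?_
    have : d ^ r * z * a * c = d ^ r + (1 + P * c) := by
      rw [← h, mul_assoc, mul_assoc, ← mul_assoc z, hac, mul_add, mul_one]
    rw [hec, sub_mul, this]
    abel
  rw [(eq_mul_inv_iff_mul_eq₀ hz).mpr hez]
  exact S.mul_mem (S.sub_mem (S.mul_mem (S.mul_mem (S.pow_mem hdS _) hzS) haS) hP) hziS

/-- The term before four consecutive terms lies in the subalgebra they generate with `z⁻¹`. -/
theorem mem_backward {x a b c d z : D} {r s : ℕ} (hs : 0 < s) (hz : z ≠ 0) (hb : b ≠ 0)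
    (hcb : c * z * b = b * c) (hbx : b * z * x = 1 + a ^ r) (hca : c * z * a = 1 + b ^ s)
    (hdb : d * z * b = 1 + c ^ r) (hzS : z ∈ S) (hziS : z⁻¹ ∈ S)
    (haS : a ∈ S) (hbS : b ∈ S) (hcS : c ∈ S) (hdS : d ∈ S) : x ∈ S := by
  obtain ⟨P, hP, h⟩ := exists_pow_mul_pow_eq_one_add_mul' S hs hcb hca haS hbS hcS r
  have hbd : b * (d * z) = 1 + (c * z) ^ r := by
    refine mul_right_cancel₀ hb ?_
    rw [mul_assoc, hdb, mul_add, add_mul, pow_mul_eq_mul_pow_of_quasi_comm hcb, one_mul, mul_one]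
  have hzx : z * x = d * z * a ^ r - P := by
    refine mul_left_cancel₀ hb ?_
    have : b * (d * z * a ^ r) = a ^ r + (1 + b * P) := by
      rw [← h, ← mul_assoc, hbd, add_mul, one_mul]
    rw [← mul_assoc, hbx, mul_sub, this]
    abel
  rw [(eq_inv_mul_iff_mul_eq₀ hz).mpr hzx]
  exact S.mul_mem hziS (S.sub_mem (S.mul_mem (S.mul_mem hdS hzS) (S.pow_mem haS _)) hP)

end Exchange

/-! ### Augmentation and positivity. -/

/-- The augmentation `y₁, y₂ ↦ 1`. -/
noncomputable def augmentation : NCLaurent →ₐ[ℚ] ℚ := MonoidAlgebra.lift ℚ ℚ (FreeGroup (Fin 2)) 1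

@[simp]
theorem augmentation_mono (g : FreeGroup (Fin 2)) : augmentation (mono g) = 1 := by
  simp [augmentation, mono]

theorem mono_mul (g h : FreeGroup (Fin 2)) : mono (g * h) = mono g * mono h := map_mul _ _ _

theorem mono_one : mono 1 = 1 := map_one _

section Embedding

variable {D : Type*} [DivisionRing D] [Algebra ℚ D] (ι : NCLaurent →ₐ[ℚ] D)

theorem map_mono_mul_map_mono_inv (g : FreeGroup (Fin 2)) : ι (mono g) * ι (mono g⁻¹) = 1 := by
  rw [← map_mul, ← mono_mul, mul_inv_cancel, mono_one, map_one]

theorem map_mono_ne_zero (g : FreeGroup (Fin 2)) : ι (mono g) ≠ 0 :=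
  left_ne_zero_of_mul_eq_one (map_mono_mul_map_mono_inv ι g)

theorem map_mono_inv (g : FreeGroup (Fin 2)) : ι (mono g⁻¹) = (ι (mono g))⁻¹ :=
  (inv_eq_of_mul_eq_one_right (map_mono_mul_map_mono_inv ι g)).symm

/-- An element of `D` is positive if it is a Laurent polynomial with positive augmentation. -/
def IsPositive (d : D) : Prop := ∃ p, ι p = d ∧ 0 < augmentation p

variable {ι}

theorem isPositive_mono (g : FreeGroup (Fin 2)) : IsPositive ι (ι (mono g)) :=
  ⟨mono g, rfl, by simp⟩

theorem IsPositive.ne_zero (hι : Function.Injective ι) {d : D} (hd : IsPositive ι d) : d ≠ 0 := by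
  obtain ⟨p, rfl, hp⟩ := hd
  refine (map_ne_zero_iff ι hι).mpr ?_
  rintro rfl
  simp at hp

theorem augmentation_exchange (hι : Function.Injective ι) {p q t : NCLaurent} {r : ℕ}
    (h : ι p * ι (mono gz) * ι q = 1 + ι t ^ r) :
    augmentation p * augmentation q = 1 + augmentation t ^ r := by
  have h' : p * mono gz * q = 1 + t ^ r := hι (by simpa using h)
  simpa using congrArg augmentation h'

/-- Membership in `ι.range` must be known first, because the augmentation is defined only on Laurent
polynomials. -/
theorem IsPositive.forward (hι : Function.Injective ι) {c d e : D} {r : ℕ} (hc : IsPositive ι c)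
    (hd : IsPositive ι d) (he : e ∈ ι.range) (h : e * ι (mono gz) * c = 1 + d ^ r) :
    IsPositive ι e := by
  obtain ⟨p, rfl⟩ := he
  obtain ⟨q, rfl, hq⟩ := hc
  obtain ⟨t, rfl, ht⟩ := hd
  have := augmentation_exchange hι h
  exact ⟨p, rfl, pos_of_mul_pos_left (this ▸ by positivity) hq.le⟩

theorem IsPositive.backward (hι : Function.Injective ι) {x a b : D} {r : ℕ} (hb : IsPositive ι b)
    (ha : IsPositive ι a) (hx : x ∈ ι.range) (h : b * ι (mono gz) * x = 1 + a ^ r) :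
    IsPositive ι x := by
  obtain ⟨p, rfl⟩ := hx
  obtain ⟨q, rfl, hq⟩ := hb
  obtain ⟨t, rfl, ht⟩ := ha
  have := augmentation_exchange hι h
  exact ⟨p, rfl, pos_of_mul_pos_right (this ▸ by positivity) hq.le⟩

/-! ### Windows of four consecutive terms. -/

variable (ι) in
/-- Four consecutive terms of a cluster sequence, all positive and lying in `S`. -/
structure IsWindow (S : Subalgebra ℚ D) (r s : ℕ) (a b c d : D) : Prop where
  pos : IsPositive ι a ∧ IsPositive ι b ∧ IsPositive ι c ∧ IsPositive ι d
  mem : a ∈ S ∧ b ∈ S ∧ c ∈ S ∧ d ∈ S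
  quasi_comm : c * ι (mono gz) * b = b * c
  left : c * ι (mono gz) * a = 1 + b ^ r
  right : d * ι (mono gz) * b = 1 + c ^ s

theorem IsWindow.forward (hι : Function.Injective ι) {S : Subalgebra ℚ D} (hS : S ≤ ι.range)
    (hz : ι (mono gz) ∈ S) (hzi : ι (mono gz⁻¹) ∈ S) {r s : ℕ} (hs : 0 < s) {a b c d e : D}
    (h : IsWindow ι S r s a b c d) (hec : e * ι (mono gz) * c = 1 + d ^ r) :
    IsWindow ι S s r b c d e := by
  obtain ⟨⟨-, pb, pc, pd⟩, ⟨ma, mb, mc, md⟩, hcb, hca, hdb⟩ := h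
  have hz0 := map_mono_ne_zero ι gz
  have me : e ∈ S := mem_forward S hs hz0 (pc.ne_zero hι) hcb hca hdb hec hz
    (map_mono_inv ι gz ▸ hzi) ma mb mc md
  exact ⟨⟨pb, pc, pd, pc.forward hι pd (hS me) hec⟩, ⟨mb, mc, md, me⟩,
    quasi_comm_forward hz0 (pb.ne_zero hι) hcb hdb, hdb, hec⟩

theorem IsWindow.backward (hι : Function.Injective ι) {S : Subalgebra ℚ D} (hS : S ≤ ι.range)
    (hz : ι (mono gz) ∈ S) (hzi : ι (mono gz⁻¹) ∈ S) {r s : ℕ} (hr : 0 < r) {x a b c d : D}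
    (h : IsWindow ι S r s a b c d) (hbx : b * ι (mono gz) * x = 1 + a ^ s) :
    IsWindow ι S s r x a b c := by
  obtain ⟨⟨pa, pb, pc, -⟩, ⟨ma, mb, mc, md⟩, hcb, hca, hdb⟩ := h
  have hz0 := map_mono_ne_zero ι gz
  have mx : x ∈ S := mem_backward S hr hz0 (pb.ne_zero hι) hcb hbx hca hdb hz
    (map_mono_inv ι gz ▸ hzi) ma mb mc md
  exact ⟨⟨pb.backward hι pa (hS mx) hbx, pa, pb, pc⟩, ⟨mx, ma, mb, mc⟩,
    quasi_comm_backward hz0 (pc.ne_zero hι) hcb hca, hbx, hca⟩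

theorem exponent_add_two (r₁ r₂ : ℕ) (k : ℤ) : exponent r₁ r₂ (k + 2) = exponent r₁ r₂ k := by
  simp [exponent]

theorem exponent_pos {r₁ r₂ : ℕ} (hr₁ : 0 < r₁) (hr₂ : 0 < r₂) (k : ℤ) :
    0 < exponent r₁ r₂ k := by
  unfold exponent
  split_ifs <;> assumption

/-! ### From the weak exchange relations to the full ones. -/

variable (ι) in
/-- A sequence with the given initial terms which satisfies the exchange relation wherever
the term to be divided by, looking away from `y₁, y₂`, does not vanish. -/
structure IsWeakClusterSeq (r₁ r₂ : ℕ) (y : ℤ → D) : Prop where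
  one : y 1 = ι (mono g₁)
  two : y 2 = ι (mono g₂)
  forward : ∀ k : ℤ, 2 ≤ k → y (k - 1) ≠ 0 →
    y (k + 1) * ι (mono gz) * y (k - 1) = 1 + y k ^ exponent r₁ r₂ k
  backward : ∀ k : ℤ, k ≤ 1 → y (k + 1) ≠ 0 →
    y (k + 1) * ι (mono gz) * y (k - 1) = 1 + y k ^ exponent r₁ r₂ k

theorem IsClusterSeq.isWeakClusterSeq {r₁ r₂ : ℕ} {y : ℤ → D} (h : IsClusterSeq r₁ r₂ ι y) :
    IsWeakClusterSeq ι r₁ r₂ y :=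
  ⟨h.one, h.two, fun k _ _ => h.rec_eq k, fun k _ _ => h.rec_eq k⟩

namespace IsWeakClusterSeq

variable {r₁ r₂ : ℕ} {y : ℤ → D}

theorem zero_mul (h : IsWeakClusterSeq ι r₁ r₂ y) :
    y 2 * ι (mono gz) * y 0 = 1 + y 1 ^ exponent r₁ r₂ 1 := by
  simpa using h.backward 1 le_rfl (by simpa [h.two] using map_mono_ne_zero ι g₂)

theorem mul_three (h : IsWeakClusterSeq ι r₁ r₂ y) :
    y 3 * ι (mono gz) * y 1 = 1 + y 2 ^ exponent r₁ r₂ 2 := by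
  simpa using h.forward 2 le_rfl (by simpa [h.one] using map_mono_ne_zero ι g₁)

/-- The divisor is a monomial, hence already a unit among Laurent polynomials. -/
theorem zero_mem_range (h : IsWeakClusterSeq ι r₁ r₂ y) : y 0 ∈ ι.range := by
  have h0 := (eq_inv_mul_iff_mul_eq₀ (mul_ne_zero (h.two ▸ map_mono_ne_zero ι g₂)
    (map_mono_ne_zero ι gz))).mpr h.zero_mul
  rw [h0, h.one, h.two, mul_inv_rev, ← map_mono_inv, ← map_mono_inv]
  exact ⟨mono gz⁻¹ * mono g₂⁻¹ * (1 + mono g₁ ^ exponent r₁ r₂ 1), by simp⟩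

theorem three_mem_range (h : IsWeakClusterSeq ι r₁ r₂ y) : y 3 ∈ ι.range := by
  have h3 := (eq_mul_inv_iff_mul_eq₀ (mul_ne_zero (map_mono_ne_zero ι gz)
    (h.one ▸ map_mono_ne_zero ι g₁))).mpr ((mul_assoc _ _ _).symm.trans h.mul_three)
  rw [h3, h.one, h.two, mul_inv_rev, ← map_mono_inv, ← map_mono_inv]
  exact ⟨(1 + mono g₂ ^ exponent r₁ r₂ 2) * (mono g₁⁻¹ * mono gz⁻¹), by simp⟩

theorem clusterAlgebra_le (h : IsWeakClusterSeq ι r₁ r₂ y) : clusterAlgebra ι y ≤ ι.range := by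
  refine Algebra.adjoin_le ?_
  rintro _ (rfl | rfl | rfl | rfl | rfl | rfl)
  exacts [h.zero_mem_range, ⟨_, h.one.symm⟩, ⟨_, h.two.symm⟩, h.three_mem_range, ⟨_, rfl⟩,
    ⟨_, rfl⟩]

theorem isWindow_one (hι : Function.Injective ι) (h : IsWeakClusterSeq ι r₁ r₂ y) :
    IsWindow ι (clusterAlgebra ι y) (exponent r₁ r₂ 1) (exponent r₁ r₂ 2)
      (y 0) (y 1) (y 2) (y 3) := by
  have p1 : IsPositive ι (y 1) := h.one ▸ isPositive_mono g₁
  have p2 : IsPositive ι (y 2) := h.two ▸ isPositive_mono g₂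
  refine ⟨⟨p2.backward hι p1 h.zero_mem_range h.zero_mul, p1, p2,
    p1.forward hι p2 h.three_mem_range h.mul_three⟩, ⟨?_, ?_, ?_, ?_⟩, ?_, h.zero_mul, h.mul_three⟩
  iterate 4 exact Algebra.subset_adjoin (by simp)
  -- Here the choice of `z` enters: `g₂ * gz * g₁ = g₁ * g₂`.
  rw [h.one, h.two, ← map_mul, ← map_mul, ← map_mul, ← mono_mul, ← mono_mul, ← mono_mul]
  simp [gz, mul_assoc]

theorem isWindow (hι : Function.Injective ι) (hr₁ : 0 < r₁) (hr₂ : 0 < r₂)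
    (h : IsWeakClusterSeq ι r₁ r₂ y) (k : ℤ) :
    IsWindow ι (clusterAlgebra ι y) (exponent r₁ r₂ k) (exponent r₁ r₂ (k + 1))
      (y (k - 1)) (y k) (y (k + 1)) (y (k + 2)) := by
  have hz : ι (mono gz) ∈ clusterAlgebra ι y := Algebra.subset_adjoin (by simp)
  have hzi : ι (mono gz⁻¹) ∈ clusterAlgebra ι y := Algebra.subset_adjoin (by simp)
  rcases le_total 1 k with hk | hk
  · induction k, hk using Int.leInduction with
    | base => simpa using h.isWindow_one hι
    | succ k hk ih =>
      -- The current window already shows that the divisor `y (k + 1)` is nonzero, so the weak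
      -- relation applies.
      have e := h.forward (k + 2) (by lia)
        (by simpa [show k + 2 - 1 = k + 1 by ring] using ih.pos.2.2.1.ne_zero hι)
      rw [exponent_add_two, show k + 2 - 1 = k + 1 by ring] at e
      have := ih.forward hι h.clusterAlgebra_le hz hzi (exponent_pos hr₁ hr₂ _) e
      rw [← exponent_add_two r₁ r₂ k] at this
      convert this using 2 <;> ring
  · induction k, hk using Int.leInductionDown with
    | base => simpa using h.isWindow_one hι
    | pred k hk ih =>
      have e := h.backward (k - 1) (by lia) (by simpa using ih.pos.2.1.ne_zero hι)
      rw [← exponent_add_two r₁ r₂ (k - 1), show k - 1 + 2 = k + 1 by ring,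
        show k - 1 + 1 = k by ring] at e
      have := ih.backward hι h.clusterAlgebra_le hz hzi (exponent_pos hr₁ hr₂ _) e
      rw [show k + 1 = k - 1 + 2 by ring, exponent_add_two] at this
      convert this using 2 <;> ring

theorem isClusterSeq (hι : Function.Injective ι) (hr₁ : 0 < r₁) (hr₂ : 0 < r₂)
    (h : IsWeakClusterSeq ι r₁ r₂ y) : IsClusterSeq r₁ r₂ ι y :=
  ⟨h.one, h.two, fun k => (h.isWindow hι hr₁ hr₂ k).left⟩

end IsWeakClusterSeq

/-! ### Uniqueness. -/

theorem IsClusterSeq.unique (hι : Function.Injective ι) {r₁ r₂ : ℕ} (hr₁ : 0 < r₁) (hr₂ : 0 < r₂)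
    {y y' : ℤ → D} (h : IsClusterSeq r₁ r₂ ι y) (h' : IsClusterSeq r₁ r₂ ι y') : y = y' := by
  have hz := map_mono_ne_zero ι gz
  have h0 (k : ℤ) : y k ≠ 0 := (h.isWeakClusterSeq.isWindow hι hr₁ hr₂ k).pos.2.1.ne_zero hι
  -- The recurrence has order two, so the induction carries pairs. Nonvanishing of `y` suffices, as
  -- the divisors agree by induction.
  have key (k : ℤ) : y k = y' k ∧ y (k + 1) = y' (k + 1) := by
    induction k using Int.inductionOn' (b := 1) with
    | zero => simp [h.one, h'.one, h.two, h'.two]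
    | succ k hk ih =>
      refine ⟨ih.2, mul_right_cancel₀ (mul_ne_zero hz (h0 k)) ?_⟩
      have e := h.rec_eq (k + 1)
      have e' := h'.rec_eq (k + 1)
      rw [add_sub_cancel_right] at e e'
      rw [← mul_assoc, e, ih.1, ← mul_assoc, e', ih.2]
    | pred k hk ih =>
      have e := h.rec_eq k
      have e' := h'.rec_eq k
      rw [sub_add_cancel]
      refine ⟨mul_left_cancel₀ (mul_ne_zero (h0 (k + 1)) hz) ?_, ih.1⟩
      rw [e, ih.1, ih.2, e']
  exact funext fun k => (key k).1

/-! ### Existence: the sequence computed by division. -/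

variable (ι) in
/-- The pairs `(y_{n+1}, y_{n+2})` of terms computed by the exchange relation. -/
noncomputable def forwardPair (r₁ r₂ : ℕ) : ℕ → D × D
  | 0 => (ι (mono g₁), ι (mono g₂))
  | n + 1 => ((forwardPair r₁ r₂ n).2,
      (1 + (forwardPair r₁ r₂ n).2 ^ exponent r₁ r₂ (n + 2)) *
        (ι (mono gz) * (forwardPair r₁ r₂ n).1)⁻¹)

variable (ι) in
/-- The pairs `(y_{1-n}, y_{2-n})` of terms computed by the exchange relation. -/
noncomputable def backwardPair (r₁ r₂ : ℕ) : ℕ → D × D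
  | 0 => (ι (mono g₁), ι (mono g₂))
  | n + 1 => (((backwardPair r₁ r₂ n).2 * ι (mono gz))⁻¹ *
        (1 + (backwardPair r₁ r₂ n).1 ^ exponent r₁ r₂ (1 - n)), (backwardPair r₁ r₂ n).1)

variable (ι) in
/-- The sequence computed by the exchange relation in both directions from `y₁, y₂`. -/
noncomputable def exchangeSeq (r₁ r₂ : ℕ) (k : ℤ) : D :=
  if 1 ≤ k then (forwardPair ι r₁ r₂ (k - 1).toNat).1 else (backwardPair ι r₁ r₂ (1 - k).toNat).1

theorem exchangeSeq_natCast_add_one (r₁ r₂ n : ℕ) :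
    exchangeSeq ι r₁ r₂ (n + 1) = (forwardPair ι r₁ r₂ n).1 := by
  simp [exchangeSeq]

theorem exchangeSeq_natCast_add_two (r₁ r₂ n : ℕ) :
    exchangeSeq ι r₁ r₂ (n + 2) = (forwardPair ι r₁ r₂ n).2 := by
  have := exchangeSeq_natCast_add_one (ι := ι) r₁ r₂ (n + 1)
  rwa [Nat.cast_succ, show (n : ℤ) + 1 + 1 = n + 2 by ring] at this

theorem exchangeSeq_one_sub_natCast (r₁ r₂ n : ℕ) :
    exchangeSeq ι r₁ r₂ (1 - n) = (backwardPair ι r₁ r₂ n).1 := by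
  cases n with
  -- The index `1` falls in the forward branch; both recursions start from the same pair.
  | zero => simp [exchangeSeq, forwardPair, backwardPair]
  | succ n =>
    rw [exchangeSeq, if_neg (by lia), show (1 - (1 - ((n + 1 : ℕ) : ℤ))).toNat = n + 1 by lia]

theorem exchangeSeq_two_sub_natCast (r₁ r₂ n : ℕ) :
    exchangeSeq ι r₁ r₂ (2 - n) = (backwardPair ι r₁ r₂ n).2 := by
  cases n with
  | zero => simpa [forwardPair, backwardPair] using exchangeSeq_natCast_add_two (ι := ι) r₁ r₂ 0
  | succ n =>
    have := exchangeSeq_one_sub_natCast (ι := ι) r₁ r₂ n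
    rwa [show (1 : ℤ) - n = 2 - (n + 1 : ℕ) by push_cast; ring] at this

-- Since `0⁻¹ = 0` in `D`, the computed terms satisfy an exchange relation only where the divisor is
-- nonzero, which is all that the weak notion asks.
variable (ι) in
theorem isWeakClusterSeq_exchangeSeq (r₁ r₂ : ℕ) :
    IsWeakClusterSeq ι r₁ r₂ (exchangeSeq ι r₁ r₂) where
  one := by simpa [forwardPair] using exchangeSeq_natCast_add_one (ι := ι) r₁ r₂ 0
  two := by simpa [forwardPair] using exchangeSeq_natCast_add_two (ι := ι) r₁ r₂ 0
  forward k hk h0 := by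
    obtain ⟨n, rfl⟩ : ∃ n : ℕ, k = n + 2 := ⟨(k - 2).toNat, by lia⟩
    have e := exchangeSeq_natCast_add_two (ι := ι) r₁ r₂ (n + 1)
    rw [show ((n + 1 : ℕ) : ℤ) + 2 = n + 2 + 1 by push_cast; ring] at e
    rw [show (n : ℤ) + 2 - 1 = n + 1 by ring, exchangeSeq_natCast_add_one] at h0 ⊢
    rw [e, exchangeSeq_natCast_add_two, forwardPair, mul_assoc]
    exact inv_mul_cancel_right₀ (mul_ne_zero (map_mono_ne_zero ι gz) h0) _
  backward k hk h0 := by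
    obtain ⟨n, rfl⟩ : ∃ n : ℕ, k = 1 - n := ⟨(1 - k).toNat, by lia⟩
    have e := exchangeSeq_one_sub_natCast (ι := ι) r₁ r₂ (n + 1)
    rw [show (1 : ℤ) - (n + 1 : ℕ) = 1 - n - 1 by push_cast; ring] at e
    rw [show (1 : ℤ) - n + 1 = 2 - n by ring, exchangeSeq_two_sub_natCast] at h0 ⊢
    rw [e, exchangeSeq_one_sub_natCast, backwardPair]
    exact mul_inv_cancel_left₀ (mul_ne_zero h0 (map_mono_ne_zero ι gz)) _

end Embedding

end NCLaurent

theorem mainTheorem2 (r₁ r₂ : ℕ) (hr₁ : 0 < r₁) (hr₂ : 0 < r₂)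
    {D : Type*} [DivisionRing D] [Algebra ℚ D]
    (ι : NCLaurent →ₐ[ℚ] D) (hι : Function.Injective ι) :
    (∃! y : ℤ → D, NCLaurent.IsClusterSeq r₁ r₂ ι y) ∧
    ∀ y : ℤ → D, NCLaurent.IsClusterSeq r₁ r₂ ι y →
      NCLaurent.clusterAlgebra ι y ≤ ι.range ∧
      ∀ k : ℤ, y k ∈ NCLaurent.clusterAlgebra ι y ∧ ∃ p : NCLaurent, ι p = y k := by
  refine ⟨⟨NCLaurent.exchangeSeq ι r₁ r₂, ?_, fun y hy => ?_⟩, fun y hy => ?_⟩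
  · exact (NCLaurent.isWeakClusterSeq_exchangeSeq ι r₁ r₂).isClusterSeq hι hr₁ hr₂
  · exact hy.unique hι hr₁ hr₂
      ((NCLaurent.isWeakClusterSeq_exchangeSeq ι r₁ r₂).isClusterSeq hι hr₁ hr₂)
  · have hle := hy.isWeakClusterSeq.clusterAlgebra_le
    refine ⟨hle, fun k => ?_⟩
    have hk := (hy.isWeakClusterSeq.isWindow hι hr₁ hr₂ k).mem.2.1
    exact ⟨hk, hle hk⟩
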